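/- **Model.** Time proceeds in slots $0,1,2,\dots$; $\kappa$ is the security parameter. There are $N$ players; some are corrupted. Each player may hold stake and may act as a miner. A protocol $\Pi$ consists of an arbitrary trusted setup (a joint distribution of private strings, depending on $\kappa$, $N$ and the initial stake) and of the program that an honest player runs in each slot in which it is online, using its own random tape, the messages delivered to it, the transactions that the environment gives to it, and a random oracle $H:\{0,1\}^*\to\{0,1\}^\kappa$; the program yields messages, which are diffused, and a confirmed ledger, a finite sequence of transactions that the player has received (from the environment or in messages). Each active honest miner may ask one $\mathtt{compute}$ query per slot; $\mathtt{verify}$ queries $(x,y)$ (has $x$ been computed, with answer $y$?) are free. The adversary's allowance of $\mathtt{compute}$ queries grows by one whenever a corrupted miner is active and drops by one with each query. The adversary, together with the environment, fixes $N$, the initial stake and the corrupted players, and decides in each slot, with knowledge of everything that honest players have sent, who is online, which miners are active, which transactions each player receives, and the delivery and injection of messages, subject to this: a message diffused by an honest player in slot $r$ has reached every other honest player online in a slot $r'\ge r+\Delta$ by slot $r'$ (also a player that came online only later). In each slot at least one honest player is online and at least one miner is active; total stake is positive. Transactions are payments of stake; the stake distribution in the view of a player is the initial one changed by its confirmed ledger.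 Let $h_r$ and $n_r$ be the numbers of honest and of all active miners in slot $r$. For a window $W$ of consecutive slots let $\beta_w^W=1-\min_{r\in W}h_r/n_r$, and let $\beta_s^W$ be the maximum fraction of adversarial stake over the views of all honest online players in all slots of $W$. The adversary is *$(\theta,m,\omega)$-bounded* if, for all coins, $\omega\beta_w^W+(1-\omega)\beta_s^W\le\theta$ for every window $W$ of at most $m$ slots. Write $L_p(r)$ for the confirmed ledger of an honest player $p$ that is online in slot $r$. *Persistence*: if $r_1+\Delta<r_2$, then $L_{p_1}(r_1)$ is a prefix of $L_{p_2}(r_2)$. *Liveness with parameter $u$*: if a transaction is received by all honest online players in each of more than $u$ consecutive slots, the last being $r$, then it is at one and the same position in the ledgers $L_p(r)$ of all honest players $p$ online in slot $r$. The protocol $\Pi$ *maintains a robust public transaction ledger* against a class of adversaries if there is $u=u(\kappa)$, at most polynomial in $\kappa$, such that, for each adversary in the class and executions with polynomially many slots and players, persistence and liveness both hold except with probability negligible in $\kappa$. **Statement.** Let $\Delta\ge1$, $m\in\mathbb N$, $\omega\in[0,1]$, and let $\Pi$ be any protocol. 1. $\Pi$ does not maintain a robust public transaction ledger against $(1/2,m,\omega)$-bounded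 adversaries. 2. (The stake-work bound is necessary, up to the slack.) Let $\gamma\ge1$, $0<\alpha_0\le1/2$, $s\in\mathbb N$, $\theta\in\mathbb R$. Suppose that $\Pi$ maintains a robust public transaction ledger against those $(\theta,m,\omega)$-bounded adversaries for which, moreover: the sequences $(h_r)$ and $(n_r)$ are $(\gamma,s)$-respecting (on any at most $s$ consecutive slots the maximum is at most $\gamma$ times the minimum); $h_r\ge\alpha_0n_r$ for all $r$; honest players with positive stake in the view of some honest online player are online; and honest players that have come online stay online. Then $\theta<1/2$. -/

import Mathlib

open MeasureTheory Filter

namespace HybridLedger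

/-! ### Transactions, messages, oracle access -/

/-- A transaction: a payment of `amount` units of stake (possibly `0`) between two accounts.
The account of a player is the number of the player. -/
structure Tx where
  id : ℕ
  sender : ℕ
  receiver : ℕ
  amount : ℕ
deriving DecidableEq

/-- A message: a bit string together with the transactions it carries. Transactions are listed
separately because they are signed by their issuers: a node can relay them, not invent them. -/
structure Msg where
  data : List Bool
  txs : List Tx

/-- A computation with (adaptive) access to the random oracle functionality. A `compute` query is
answered by `none` if the budget of `compute` queries is exhausted; `verify` queries are free. -/
inductive OracleProg (α : Type) : Type
  | ret (a : α) : OracleProg α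
  | compute (x : List Bool) (k : Option (List Bool) → OracleProg α) : OracleProg α
  | verify (x y : List Bool) (k : Bool → OracleProg α) : OracleProg α

/-- Run a program. `H` is the random function, `T` the set of inputs that have been computed so far
(so the table of the oracle is `{(x, H x) | x ∈ T}`), and `b` the number of `compute` queries that
may still be asked. Returns the result, the new set of computed inputs and the remaining budget. -/
def OracleProg.run {α : Type} (H : List Bool → List Bool) :
    OracleProg α → Finset (List Bool) → ℕ → α × Finset (List Bool) × ℕ
  | .ret a, T, b => (a, T, b)
  | .compute _ k, T, 0 => (k none).run H T 0
  | .compute x k, T, b + 1 => (k (some (H x))).run H (insert x T) b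
  | .verify x y k, T, b => (k (decide (x ∈ T ∧ H x = y))).run H T b

/-! ### Protocols and adversaries -/

/-- The initial private inputs of the players. -/
def Setup : Type := ℕ → List Bool

instance : MeasurableSpace Setup := ⊤

/-- A protocol, run by every honest player. `κ` is the security parameter.
* `setup κ N stake` is a trusted setup: a joint distribution of the initial strings (genesis block,
  public keys, private keys, correlated randomness) of `N` players with the given initial stake.
* `init` makes the local state out of a player's initial string and its random tape.
* `step` is the computation of one slot, from the local state, the number of the slot, the messages
  delivered and the transactions received in this slot; it returns the new state and the messages
  that the player diffuses.
* `ledger` reads the confirmed ledger off the local state. -/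
structure Protocol where
  State : Type
  setup : (κ N : ℕ) → (stake : ℕ → ℕ) → PMF Setup
  init : (κ : ℕ) → List Bool → (ℕ → Bool) → State
  step : (κ : ℕ) → State → (slot : ℕ) → (inbox : List Msg) → (txs : List Tx) →
    OracleProg (State × List Msg)
  ledger : State → List Tx

/-- What the adversary and the environment decide for one slot: the players that are online, the
players that are active as miners, the transactions that each player receives from the environment,
and the messages that are delivered to each player (in this order). -/
structure SlotPlan where
  online : Finset ℕ
  mining : Finset ℕ
  txs : ℕ → List Tx
  inbox : ℕ → List Msg

/-- An adversary, together with the environment that it colludes with. The players are the numbers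
below `N`; `stake` is the initial stake, `corrupt` the set of corrupted players. `init` depends on
the initial strings and the tapes of the corrupted players, and on the adversary's own tape. At the
end of each slot, `step` sees the messages that the honest players have diffused in the slot and
their confirmed ledgers, queries the oracle, and decides the next slot. -/
structure Adversary where
  State : Type
  N : ℕ
  stake : ℕ → ℕ
  corrupt : Finset ℕ
  init : (setup : ℕ → List Bool) → (tapes : ℕ → ℕ → Bool) → (tape : ℕ → Bool) → State × SlotPlan
  step : State → (slot : ℕ) → (sent : ℕ → List Msg) → (ledgers : ℕ → List Tx) →
    OracleProg (State × SlotPlan)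

/-! ### Randomness -/

/-- Indices of the independent fair coins: the tapes of the players, the tape of the adversary and
the bits of the random oracle. -/
inductive CoinIdx : Type
  | player (p i : ℕ) : CoinIdx
  | adversary (i : ℕ) : CoinIdx
  | oracle (x : List Bool) (i : ℕ) : CoinIdx

/-- All the randomness of an execution. -/
abbrev Sample : Type := Setup × (CoinIdx → Bool)

noncomputable def fairCoin : Measure Bool := (PMF.uniformOfFintype Bool).toMeasure

instance : IsProbabilityMeasure fairCoin := by
  unfold fairCoin; infer_instance

/-- The initial strings follow the setup of the protocol; independently, all coins are fair and
independent. -/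
noncomputable def Protocol.sampleMeasure (P : Protocol) (κ N : ℕ) (stake : ℕ → ℕ) :
    Measure Sample :=
  (P.setup κ N stake).toMeasure.prod (Measure.infinitePi fun _ : CoinIdx => fairCoin)

/-- The random function `{0,1}* → {0,1}^κ`. -/
def hash (κ : ℕ) (c : CoinIdx → Bool) (x : List Bool) : List Bool :=
  List.ofFn fun j : Fin κ => c (.oracle x j)

/-! ### Executions -/

/-- A node: the local state of the protocol, and the transactions received so far. -/
structure Node (P : Protocol) where
  st : P.State
  known : Finset Tx

/-- The confirmed ledger of a node. It is made of transactions that the node has received. -/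
def Node.ledger {P : Protocol} (n : Node P) : List Tx :=
  (P.ledger n.st).filter (· ∈ n.known)

/-- One slot of an honest node: the new node, the messages that it diffuses and the new set of
computed oracle inputs. An active miner may ask one `compute` query, another node none. -/
def nodeStep (P : Protocol) (κ : ℕ) (H : List Bool → List Bool) (T : Finset (List Bool))
    (mines : Bool) (slot : ℕ) (inbox : List Msg) (txs : List Tx) (n : Node P) :
    Node P × List Msg × Finset (List Bool) :=
  let known := n.known ∪ txs.toFinset ∪ (inbox.flatMap Msg.txs).toFinset
  let out := (P.step κ n.st slot inbox txs).run H T (if mines then 1 else 0)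
  (⟨out.1.1, known⟩,
    out.1.2.map (fun μ => ⟨μ.data, μ.txs.filter (· ∈ known)⟩),
    out.2.1)

/-- The honest players that are online under a plan. -/
def Adversary.honestOnline (A : Adversary) (pl : SlotPlan) : Finset ℕ :=
  pl.online.filter fun p => p < A.N ∧ p ∉ A.corrupt

/-- The honest active miners. -/
def Adversary.honestMiners (A : Adversary) (pl : SlotPlan) : Finset ℕ :=
  (A.honestOnline pl).filter fun p => p ∈ pl.mining

/-- The corrupted active miners. -/
def Adversary.corruptMiners (A : Adversary) (pl : SlotPlan) : Finset ℕ :=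
  pl.mining.filter fun p => p < A.N ∧ p ∈ A.corrupt

/-- The situation at the start of a slot. `budget` is the number of `compute` queries that the
adversary may ask: it grows by one with each activation of a corrupted miner and drops by one with
each `compute` query of the adversary. -/
structure Config (P : Protocol) (A : Adversary) where
  nodes : ℕ → Node P
  adv : A.State
  plan : SlotPlan
  table : Finset (List Bool)
  budget : ℕ

/-- The outcome of a slot for player `p`; only honest online players run the protocol. -/
def Config.nodeOut {P : Protocol} {A : Adversary} (c : Config P A) (κ : ℕ)
    (H : List Bool → List Bool) (slot p : ℕ) : Node P × List Msg × Finset (List Bool) :=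
  if p ∈ A.honestOnline c.plan then
    nodeStep P κ H c.table (decide (p ∈ c.plan.mining)) slot (c.plan.inbox p) (c.plan.txs p)
      (c.nodes p)
  else (c.nodes p, [], c.table)

/-- One slot: first the honest online players act, then the adversary. -/
def Config.next {P : Protocol} {A : Adversary} (c : Config P A) (κ : ℕ)
    (H : List Bool → List Bool) (slot : ℕ) : Config P A :=
  let out := c.nodeOut κ H slot
  let T := c.table ∪ (A.honestOnline c.plan).biUnion fun p => (out p).2.2
  let adv := (A.step c.adv slot (fun p => (out p).2.1) (fun p => (out p).1.ledger)).run H T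
    (c.budget + (A.corruptMiners c.plan).card)
  { nodes := fun p => (out p).1
    adv := adv.1.1
    plan := adv.1.2
    table := adv.2.1
    budget := adv.2.2 }

/-- The configuration at the start of slot `0`. -/
def initConfig (P : Protocol) (A : Adversary) (κ : ℕ) (w : Sample) : Config P A :=
  let a := A.init (fun p => if p ∈ A.corrupt then w.1 p else [])
    (fun p i => if p ∈ A.corrupt then w.2 (.player p i) else false)
    (fun i => w.2 (.adversary i))
  { nodes := fun p => ⟨P.init κ (w.1 p) (fun i => w.2 (.player p i)), ∅⟩
    adv := a.1
    plan := a.2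
    table := ∅
    budget := 0 }

/-- The configuration at the start of each slot. -/
def config (P : Protocol) (A : Adversary) (κ : ℕ) (w : Sample) : ℕ → Config P A
  | 0 => initConfig P A κ w
  | r + 1 => (config P A κ w r).next κ (hash κ w.2) r

/-- The record of an execution with slots `0, …, len - 1`. -/
structure Trace where
  len : ℕ
  N : ℕ
  stake : ℕ → ℕ
  corrupt : Finset ℕ
  /-- honest online players of a slot -/
  honest : ℕ → Finset ℕ
  /-- number of honest active miners of a slot -/
  h : ℕ → ℕ
  /-- number of active miners of a slot -/
  n : ℕ → ℕ
  /-- transactions that a player receives from the environment in a slot -/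
  txs : ℕ → ℕ → List Tx
  /-- messages delivered to a player in a slot -/
  inbox : ℕ → ℕ → List Msg
  /-- messages diffused by a player in a slot -/
  sent : ℕ → ℕ → List Msg
  /-- confirmed ledger of a player in a slot -/
  ledger : ℕ → ℕ → List Tx

/-- The execution of `P` with the adversary `A`, with fixed randomness `w`. -/
def trace (P : Protocol) (A : Adversary) (κ len : ℕ) (w : Sample) : Trace where
  len := len
  N := A.N
  stake := A.stake
  corrupt := A.corrupt.filter (· < A.N)
  honest r := A.honestOnline (config P A κ w r).plan
  h r := (A.honestMiners (config P A κ w r).plan).card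
  n r := (A.honestMiners (config P A κ w r).plan).card +
    (A.corruptMiners (config P A κ w r).plan).card
  txs r := (config P A κ w r).plan.txs
  inbox r := (config P A κ w r).plan.inbox
  sent r p := ((config P A κ w r).nodeOut κ (hash κ w.2) r p).2.1
  ledger r p := ((config P A κ w r).nodeOut κ (hash κ w.2) r p).1.ledger

namespace Trace

/-! ### The ground rules of the model -/

/-- Delay at most `Δ`: a message that an honest player diffuses in slot `r` has been delivered to
every other honest player that is online in a slot `r' ≥ r + Δ`, by this slot. (A player that comes
online later finds the messages that were sent in its absence.) -/
def Synchronous (Δ : ℕ) (E : Trace) : Prop :=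
  ∀ r r' p p', r' < E.len → r + Δ ≤ r' → p ∈ E.honest r → p' ∈ E.honest r' → p ≠ p' →
    ∀ μ ∈ E.sent r p, ∃ t, r < t ∧ t ≤ r' ∧ p' ∈ E.honest t ∧ μ ∈ E.inbox t p'

/-- There is some stake, and in each slot some honest player is online and some miner is active. -/
def NonDegenerate (E : Trace) : Prop :=
  0 < ∑ p ∈ Finset.range E.N, E.stake p ∧
    ∀ r < E.len, (E.honest r).Nonempty ∧ 0 < E.n r

/-! ### Resources -/

/-- The effect of a transaction on the stake of `N` players (none if it is not covered). -/
def transfer (N : ℕ) (s : ℕ → ℕ) (tx : Tx) : ℕ → ℕ :=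
  if tx.sender < N ∧ tx.receiver < N ∧ tx.amount ≤ s tx.sender then
    fun p => s p - (if p = tx.sender then tx.amount else 0) +
      (if p = tx.receiver then tx.amount else 0)
  else s

/-- The stake distribution in the view of player `q` in slot `r`: the initial one, changed by the
transactions of the confirmed ledger of `q`. A repeated transaction counts once. -/
def stakeView (E : Trace) (r q : ℕ) : ℕ → ℕ :=
  (E.ledger r q).eraseDups.foldl (transfer E.N) E.stake

/-- The fraction of adversarial stake in the view of `q` in slot `r`. -/
noncomputable def advStake (E : Trace) (r q : ℕ) : ℝ :=
  (∑ p ∈ E.corrupt, (E.stakeView r q p : ℝ)) / ∑ p ∈ Finset.range E.N, (E.stakeView r q p : ℝ)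

/-- `β_w` on the window of the slots `a, …, b - 1`. -/
noncomputable def betaW (E : Trace) (a b : ℕ) : ℝ :=
  1 - sInf ((fun r => (E.h r : ℝ) / E.n r) '' Set.Ico a b)

/-- `β_s` on the window of the slots `a, …, b - 1`: a maximum over the views of the honest players
(a finite set of numbers). -/
noncomputable def betaS (E : Trace) (a b : ℕ) : ℝ :=
  sSup {x | ∃ r ∈ Set.Ico a b, ∃ q ∈ E.honest r, x = E.advStake r q}

/-- The adversary is `(θ, m, ω)`-bounded. -/
def Bounded (θ : ℝ) (m : ℕ) (ω : ℝ) (E : Trace) : Prop :=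
  ∀ a b, a < b → b ≤ E.len → b - a ≤ m → ω * E.betaW a b + (1 - ω) * E.betaS a b ≤ θ

/-! ### Further assumptions on the environment -/

/-- The sequence `x` (of the slots before `len`) is `(γ, s)`-respecting. -/
def Respecting (γ : ℝ) (s len : ℕ) (x : ℕ → ℕ) : Prop :=
  ∀ a b, b ≤ len → b - a ≤ s → ∀ r ∈ Set.Ico a b, ∀ r' ∈ Set.Ico a b, (x r : ℝ) ≤ γ * x r'

/-- Work fluctuation bound. -/
def WorkRespecting (γ : ℝ) (s : ℕ) (E : Trace) : Prop :=
  Respecting γ s E.len E.h ∧ Respecting γ s E.len E.n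

/-- Work participation bound. -/
def WorkParticipation (α₀ : ℝ) (E : Trace) : Prop :=
  ∀ r < E.len, α₀ * E.n r ≤ E.h r

/-- Honest stakeholders (in the view of any honest player) are always online. -/
def StakeholdersOnline (E : Trace) : Prop :=
  ∀ r < E.len, ∀ q ∈ E.honest r, ∀ p < E.N, p ∉ E.corrupt → 0 < E.stakeView r q p →
    p ∈ E.honest r

/-- Honest players may join late, but they stay. -/
def HonestStay (E : Trace) : Prop :=
  ∀ r r', r ≤ r' → r' < E.len → E.honest r ⊆ E.honest r'

/-! ### Security -/

/-- Persistence. -/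
def Persistence (Δ : ℕ) (E : Trace) : Prop :=
  ∀ r₁ r₂ p₁ p₂, r₁ < E.len → r₂ < E.len → p₁ ∈ E.honest r₁ → p₂ ∈ E.honest r₂ → r₁ + Δ < r₂ →
    E.ledger r₁ p₁ <+: E.ledger r₂ p₂

/-- Liveness: if the honest online players all receive `tx` in each of the slots `s, …, r`, and
these are more than `u` slots, then in slot `r` they all have `tx` in the same place. -/
def Liveness (u : ℝ) (E : Trace) : Prop :=
  ∀ (tx : Tx) (s r : ℕ), s ≤ r → r < E.len → u < ((r - s + 1 : ℕ) : ℝ) →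
    (∀ t ∈ Set.Icc s r, ∀ p ∈ E.honest t, tx ∈ E.txs t p) →
    ∃ i : ℕ, ∀ p ∈ E.honest r, (E.ledger r p)[i]? = some tx

end Trace

/-- At most polynomial in the security parameter. -/
def PolyBounded (f : ℕ → ℝ) : Prop :=
  ∃ p : Polynomial ℕ, ∀ κ, f κ ≤ ((p.eval κ : ℕ) : ℝ)

/-- Negligible in the security parameter. -/
def Negligible (f : ℕ → ℝ) : Prop :=
  Asymptotics.SuperpolynomialDecay atTop (fun κ : ℕ => (κ : ℝ)) f

/-- `P` maintains a robust public transaction ledger in the `Δ`-synchronous model, against the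
adversaries that satisfy `C` whatever the coins: for some (polynomial) confirmation time `u`, for
each such adversary and in executions of polynomial length with polynomially many players,
persistence and liveness hold except with negligible probability. -/
def Protocol.MaintainsRobustLedger (P : Protocol) (Δ : ℕ) (C : Trace → Prop) : Prop :=
  ∃ u : ℕ → ℝ, PolyBounded u ∧
    ∀ (A : ℕ → Adversary) (len : ℕ → ℕ),
      PolyBounded (fun κ => (len κ : ℝ)) → PolyBounded (fun κ => ((A κ).N : ℝ)) →
      (∀ κ w, (trace P (A κ) κ (len κ) w).Synchronous Δ ∧
        (trace P (A κ) κ (len κ) w).NonDegenerate ∧ C (trace P (A κ) κ (len κ) w)) →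
      Negligible fun κ => (P.sampleMeasure κ (A κ).N (A κ).stake).real
        {w | ¬ ((trace P (A κ) κ (len κ) w).Persistence Δ ∧
          (trace P (A κ) κ (len κ) w).Liveness (u κ))}

end HybridLedger

/-! The proof is a symmetry attack. Players `0` and `1` mine in every slot, hold one unit of stake
each, never hear from each other, and are each given their own transaction again and again. One of
them is honest; the other is corrupted but follows the protocol faithfully. A third player without
stake, offline until slot `R`, then receives everything both have sent. Adversarial work and stake
are both exactly one half, so the bound 1/2 holds for every `ω` and `m`.

For fixed coins, the executions with honest player `0` and with honest player `1` both replicate one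
symmetric execution `lockstep` (`tracks_lockstep`), so the late player ends with the same ledger in
both (`trace_ledger_late`). If the properties held in both, liveness would put `payment i` into the
ledger of the isolated player `i`, which can contain nothing else, and persistence would make this
ledger a prefix of the late one, for `i = 0` and `i = 1` (`exists_prefix_lateOut`). Two prefixes of
one list are comparable, a contradiction. Hence for all coins one of the two attacks succeeds; their
success probabilities add up to at least 1 and cannot both be negligible.

The delicate point is timing. The adversary moves after the honest miner, when the oracle table has
already grown, and `verify` could reveal this. So at the end of the preceding slot the corrupted
player's program is run up to its `compute` query, and its result is tabulated for all `2 ^ κ`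
possible answers, with free `verify` queries only; the query itself is asked once its budget has
arrived (`Paused.run_resume_pause`). -/

namespace HybridLedger

/-! ### Running a program ahead of its `compute` query -/

namespace OracleProg

variable {α β : Type}

def bind : OracleProg α → (α → OracleProg β) → OracleProg β
  | .ret a, f => f a
  | .compute x k, f => .compute x fun o => (k o).bind f
  | .verify x y k, f => .verify x y fun b => (k b).bind f

theorem run_bind (H : List Bool → List Bool) (q : OracleProg α) (f : α → OracleProg β)
    (T : Finset (List Bool)) (b : ℕ) :
    (q.bind f).run H T b = (f (q.run H T b).1).run H (q.run H T b).2.1 (q.run H T b).2.2 := by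
  induction q generalizing T b with
  | ret a => rfl
  | compute x k ih => cases b <;> simp only [bind, run, ih]
  | verify x y k ih => simp only [bind, run, ih]

/-- The answers to `verify` queries, given the set of computed inputs. -/
def verifier (H : List Bool → List Bool) (T : Finset (List Bool)) (x y : List Bool) : Bool :=
  decide (x ∈ T ∧ H x = y)

/-- The answers to `verify` queries after the answer `y` to a `compute` query `x`. -/
def extend (V : List Bool → List Bool → Bool) (x y x' y' : List Bool) : Bool :=
  if x' = x then decide (y = y') else V x' y'

/-- A `compute` answer changes the later `verify` answers at the single input `x` only, so its
effect can be predicted from a guess of the answer, before `x` enters the table. -/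
theorem extend_verifier (H : List Bool → List Bool) (T : Finset (List Bool)) (x : List Bool) :
    extend (verifier H T) x (H x) = verifier H (insert x T) := by
  funext x' y'
  by_cases h : x' = x
  · subst h; simp [extend, verifier]
  · simp [extend, verifier, h]

/-- The result of a program without `compute` budget. -/
def finish (V : List Bool → List Bool → Bool) : OracleProg α → α
  | .ret a => a
  | .compute _ k => (k none).finish V
  | .verify x y k => (k (V x y)).finish V

/-- An honest miner has one `compute` query per slot. Once it is spent, the rest of its program
depends on the oracle through `verify` alone. -/
theorem run_zero (H : List Bool → List Bool) (T : Finset (List Bool)) (q : OracleProg α) :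
    q.run H T 0 = (q.finish (verifier H T), T, 0) := by
  induction q with
  | ret a => rfl
  | compute x k ih => simp only [run, finish, ih]
  | verify x y k ih => simp only [run, finish, ih]; rfl

end OracleProg

/-- A program that has ended, or its first `compute` query, together with the result for each
possible answer. -/
abbrev Paused (κ : ℕ) (α : Type) : Type := α ⊕ (List Bool × ((Fin κ → Bool) → α))

namespace OracleProg

variable {α : Type}

/-- Run a program with a budget of one `compute` query up to this query, and then with each
possible answer. -/
def pause (κ : ℕ) (V : List Bool → List Bool → Bool) : OracleProg α → Paused κ α
  | .ret a => .inl a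
  | .compute x k => .inr (x, fun v =>
      (k (some (List.ofFn v))).finish (extend V x (List.ofFn v)))
  | .verify x y k => (k (V x y)).pause κ V

/-- `finish` after the answer `y` to a `compute` query `x` that has not been asked, as a program. -/
def finishProg (x y : List Bool) : OracleProg α → OracleProg α
  | .ret a => .ret a
  | .compute _ k => (k none).finishProg x y
  | .verify x' y' k => .verify x' y' fun b =>
      (k (if x' = x then decide (y = y') else b)).finishProg x y

theorem run_finishProg (H : List Bool → List Bool) (T : Finset (List Bool)) (b : ℕ)
    (x y : List Bool) (q : OracleProg α) :
    (q.finishProg x y).run H T b = (q.finish (extend (verifier H T) x y), T, b) := by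
  induction q with
  | ret a => rfl
  | compute x' k ih => simp only [finishProg, finish, ih]
  | verify x' y' k ih => simp only [finishProg, run, finish, ih]; rfl

/-- Run a program for each bit string of length `n`. -/
def collect : (n : ℕ) → ((Fin n → Bool) → OracleProg α) → OracleProg ((Fin n → Bool) → α)
  | 0, f => (f Fin.elim0).bind fun a => .ret fun _ => a
  | n + 1, f =>
    (collect n fun v => f (Fin.cons false v)).bind fun g₀ =>
      (collect n fun v => f (Fin.cons true v)).bind fun g₁ =>
        .ret fun v => if v 0 then g₁ (Fin.tail v) else g₀ (Fin.tail v)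

/-- Programs that leave table and budget unchanged do not influence each other, so all of them can
be run in sequence and their results stored as a function. -/
theorem run_collect (H : List Bool → List Bool) (T : Finset (List Bool)) (b n : ℕ)
    (f : (Fin n → Bool) → OracleProg α) (g : (Fin n → Bool) → α)
    (hf : ∀ v, (f v).run H T b = (g v, T, b)) :
    (collect n f).run H T b = (g, T, b) := by
  induction n with
  | zero =>
    simp only [collect, run_bind, hf, run, Prod.mk.injEq, and_true]
    funext v
    rw [Subsingleton.elim v Fin.elim0]
  | succ n ih =>
    simp only [collect, run_bind, run, ih _ (fun v => g (Fin.cons false v)) fun v => hf _,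
      ih _ (fun v => g (Fin.cons true v)) fun v => hf _, Prod.mk.injEq, and_true]
    funext v
    by_cases h : v 0 = true
    · rw [if_pos h, ← h, Fin.cons_self_tail]
    · rw [if_neg h, ← Bool.eq_false_of_not_eq_true h, Fin.cons_self_tail]

/-- `pause` as a program: it asks only `verify` queries. -/
def pauseProg (κ : ℕ) : OracleProg α → OracleProg (Paused κ α)
  | .ret a => .ret (.inl a)
  | .compute x k =>
    (collect κ fun v => (k (some (List.ofFn v))).finishProg x (List.ofFn v)).bind
      fun g => .ret (.inr (x, g))
  | .verify x y k => .verify x y fun b => (k b).pauseProg κ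

/-- The preparation is free of charge and leaves no trace in the table, so the adversary can carry
it out one slot early. -/
theorem run_pauseProg (H : List Bool → List Bool) (T : Finset (List Bool)) (b κ : ℕ)
    (q : OracleProg α) :
    (q.pauseProg κ).run H T b = (q.pause κ (verifier H T), T, b) := by
  induction q with
  | ret a => rfl
  | compute x k ih =>
    simp only [pauseProg, run_bind, pause, run]
    rw [run_collect H T b κ _ _ fun v => run_finishProg H T b x (List.ofFn v) _]
  | verify x y k ih => simp only [pauseProg, run, pause, ih]; rfl

end OracleProg

/-- Ask the `compute` query of a paused program. -/
def Paused.resume {κ : ℕ} {α : Type} : Paused κ α → OracleProg α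
  | .inl a => .ret a
  -- The default values are never reached when there is budget: the answer then exists and has `κ`
  -- bits.
  | .inr (x, g) => .compute x fun o => .ret (g fun j => (o.getD []).getD j false)

/-- A paused program may be resumed after other players have computed: the result and the computed
input are the same as without the pause. -/
theorem Paused.run_resume_pause {α : Type} (κ : ℕ) (c : CoinIdx → Bool)
    {T T' : Finset (List Bool)} (hT : T ⊆ T') (b : ℕ) (q : OracleProg α) :
    ((q.pause κ (OracleProg.verifier (hash κ c) T)).resume.run (hash κ c) T' (b + 1)).1 =
        (q.run (hash κ c) T 1).1 ∧
      ((q.pause κ (OracleProg.verifier (hash κ c) T)).resume.run (hash κ c) T' (b + 1)).2.1 =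
        T' ∪ (q.run (hash κ c) T 1).2.1 := by
  induction q with
  | ret a => simpa [OracleProg.pause, resume, OracleProg.run] using hT
  | compute x k ih =>
    have hx : (fun j : Fin κ => (hash κ c x).getD j false) = fun j : Fin κ => c (.oracle x j) := by
      funext j; simp [hash]
    have hy : (List.ofFn fun j : Fin κ => c (.oracle x j)) = hash κ c x := rfl
    simp only [OracleProg.pause, resume, OracleProg.run, OracleProg.run_zero, Option.getD_some,
      hx, hy, OracleProg.extend_verifier, true_and]
    rw [Finset.union_insert, Finset.union_eq_left.2 hT]
  | verify x y k ih => exact ih _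

/-! ### Two isolated players in lockstep -/

/-- The transaction that is given to player `p`; it moves no stake. -/
def payment (p : ℕ) : Tx := ⟨p, p, p, 0⟩

/-- The transactions that the environment gives to player `p` in each slot. -/
def issued (p : ℕ) : List Tx := if p < 2 then [payment p] else []

/-- The players `0` and `1`, run honestly without communication, and the messages they diffused. -/
structure Lockstep (P : Protocol) where
  nodes : ℕ → Node P
  table : Finset (List Bool)
  log : List Msg

namespace Lockstep

variable {P : Protocol}

def out (l : Lockstep P) (κ : ℕ) (H : List Bool → List Bool) (slot p : ℕ) :
    Node P × List Msg × Finset (List Bool) :=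
  nodeStep P κ H l.table true slot [] (issued p) (l.nodes p)

def next (l : Lockstep P) (κ : ℕ) (H : List Bool → List Bool) (slot : ℕ) : Lockstep P where
  nodes p := if p < 2 then (l.out κ H slot p).1 else l.nodes p
  table := l.table ∪ ((l.out κ H slot 0).2.2 ∪ (l.out κ H slot 1).2.2)
  log := l.log ++ ((l.out κ H slot 0).2.1 ++ (l.out κ H slot 1).2.1)

end Lockstep

def initNode (P : Protocol) (κ : ℕ) (w : Sample) (p : ℕ) : Node P :=
  ⟨P.init κ (w.1 p) fun i => w.2 (.player p i), ∅⟩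

def lockstep (P : Protocol) (κ : ℕ) (w : Sample) : ℕ → Lockstep P
  | 0 => ⟨initNode P κ w, ∅, []⟩
  | r + 1 => (lockstep P κ w r).next κ (hash κ w.2) r

def lockstepOut (P : Protocol) (κ : ℕ) (w : Sample) (r p : ℕ) :
    Node P × List Msg × Finset (List Bool) :=
  (lockstep P κ w r).out κ (hash κ w.2) r p

/-- The first slot, at time `R`, of a player `2` that receives all messages of both players. -/
def lateOut (P : Protocol) (κ : ℕ) (w : Sample) (R : ℕ) :
    Node P × List Msg × Finset (List Bool) :=
  nodeStep P κ (hash κ w.2) (lockstep P κ w R).table false R (lockstep P κ w R).log []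
    (initNode P κ w 2)

section Lockstep

variable {P : Protocol} {κ : ℕ} {w : Sample}

/-! ### What the isolated players and the late player can know -/

theorem lockstep_nodes_two (r : ℕ) : (lockstep P κ w r).nodes 2 = initNode P κ w 2 := by
  induction r with
  | zero => rfl
  | succ r ih => simpa [lockstep, Lockstep.next] using ih

/-- Inboxes are empty, so the environment is the only source of transactions. -/
theorem lockstep_known_subset (r p : ℕ) :
    ((lockstep P κ w r).nodes p).known ⊆ (issued p).toFinset := by
  induction r with
  | zero => simp [lockstep, initNode]
  | succ r ih =>
    simp only [lockstep, Lockstep.next]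
    split_ifs
    · simpa [Lockstep.out, nodeStep] using Finset.union_subset ih subset_rfl
    · exact ih

theorem lockstepOut_known_subset (r p : ℕ) :
    (lockstepOut P κ w r p).1.known ⊆ (issued p).toFinset := by
  simpa [lockstepOut, Lockstep.out, nodeStep] using
    Finset.union_subset (lockstep_known_subset r p) subset_rfl

theorem mem_of_mem_ledger {n : Node P} {tx : Tx} (h : tx ∈ n.ledger) : tx ∈ n.known := by
  simpa using (List.mem_filter.1 h).2

theorem amount_of_mem_issued {tx : Tx} {p : ℕ} (h : tx ∈ issued p) : tx.amount = 0 := by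
  unfold issued at h
  split_ifs at h
  · rw [List.mem_singleton.1 h]; rfl
  · simp at h

theorem eq_payment_of_mem_lockstepOut {r p : ℕ} (hp : p < 2) {tx : Tx}
    (h : tx ∈ (lockstepOut P κ w r p).1.ledger) : tx = payment p := by
  simpa [issued, hp] using lockstepOut_known_subset r p (mem_of_mem_ledger h)

theorem amount_of_mem_lockstepOut {r p : ℕ} {tx : Tx}
    (h : tx ∈ (lockstepOut P κ w r p).1.ledger) : tx.amount = 0 :=
  amount_of_mem_issued (List.mem_toFinset.1 (lockstepOut_known_subset r p (mem_of_mem_ledger h)))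

/-- A node relays only transactions it has received, so even the late player sees only payments of
amount 0. -/
theorem amount_of_mem_sent {r p : ℕ} {μ : Msg} (h : μ ∈ (lockstepOut P κ w r p).2.1) {tx : Tx}
    (ht : tx ∈ μ.txs) : tx.amount = 0 := by
  obtain ⟨ν, -, rfl⟩ := List.mem_map.1 h
  have hk : tx ∈ (lockstepOut P κ w r p).1.known :=
    of_decide_eq_true (List.mem_filter.1 ht).2
  exact amount_of_mem_issued (List.mem_toFinset.1 (lockstepOut_known_subset r p hk))

theorem mem_log_iff {R : ℕ} {μ : Msg} :
    μ ∈ (lockstep P κ w R).log ↔ ∃ r < R, ∃ p < 2, μ ∈ (lockstepOut P κ w r p).2.1 := by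
  induction R with
  | zero => simp [lockstep]
  | succ R ih =>
    have hs : (lockstep P κ w (R + 1)).log = (lockstep P κ w R).log ++
      ((lockstepOut P κ w R 0).2.1 ++ (lockstepOut P κ w R 1).2.1) := rfl
    rw [hs, List.mem_append, List.mem_append, ih]
    constructor
    · rintro (⟨r, hr, h⟩ | h | h)
      · exact ⟨r, by omega, h⟩
      · exact ⟨R, by omega, 0, by omega, h⟩
      · exact ⟨R, by omega, 1, by omega, h⟩
    · rintro ⟨r, hr, p, hp, h⟩
      rcases Nat.lt_succ_iff_lt_or_eq.1 hr with hr | rfl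
      · exact .inl ⟨r, hr, p, hp, h⟩
      · interval_cases p
        · exact .inr (.inl h)
        · exact .inr (.inr h)

theorem amount_of_mem_lateOut {R : ℕ} {tx : Tx} (h : tx ∈ (lateOut P κ w R).1.ledger) :
    tx.amount = 0 := by
  have hk := mem_of_mem_ledger h
  simp only [lateOut, nodeStep, initNode, List.toFinset_nil, Finset.union_empty,
    Finset.empty_union, List.mem_toFinset, List.mem_flatMap] at hk
  obtain ⟨μ, hμ, ht⟩ := hk
  obtain ⟨r, -, p, -, hs⟩ := mem_log_iff.1 hμ
  exact amount_of_mem_sent hs ht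

end Lockstep

/-! ### The attack -/

/-- The memory of the adversary: the node of the corrupted player, which is run honestly, its
program for the next slot, and all messages so far. -/
structure Simulation (P : Protocol) (κ : ℕ) where
  node : Node P
  paused : Paused κ (P.State × List Msg)
  log : List Msg

/-- Players `0` and `1` are isolated miners; player `2` comes online in slot `R`. -/
def attackPlan (R slot : ℕ) (log : List Msg) : SlotPlan where
  online := if slot = R then {0, 1, 2} else {0, 1}
  mining := {0, 1}
  txs := issued
  inbox p := if p = 2 then log else []

/-- Player `i` is honest, and player `1 - i` is corrupted but is run honestly; player `2` cannot
tell which is which. -/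
def attack (P : Protocol) (κ R i : ℕ) : Adversary where
  State := Simulation P κ
  N := 3
  stake p := if p < 2 then 1 else 0
  corrupt := {1 - i}
  init strings tapes _ :=
    let st := P.init κ (strings (1 - i)) (tapes (1 - i))
    -- Nothing has been computed before slot 0, so every `verify` query is answered by `false`.
    (⟨⟨st, ∅⟩, (P.step κ st 0 [] (issued (1 - i))).pause κ fun _ _ => false, []⟩,
      attackPlan R 0 [])
  step s slot sent _ :=
    s.paused.resume.bind fun o =>
      let known := s.node.known ∪ (issued (1 - i)).toFinset
      let sent' := o.2.map fun μ => ⟨μ.data, μ.txs.filter (· ∈ known)⟩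
      -- The messages of player `0` come before those of player `1` whichever is honest; otherwise
      -- the order in the inbox of player `2` could give `i` away.
      let log := s.log ++ if i = 0 then sent 0 ++ sent' else sent' ++ sent 1
      ((P.step κ o.1 (slot + 1) [] (issued (1 - i))).pauseProg κ).bind fun q =>
        .ret (⟨⟨o.1, known⟩, q, log⟩, attackPlan R (slot + 1) log)

section Attack

variable {P : Protocol} {κ R i : ℕ} {w : Sample}

/-! ### Both attacks replicate the lockstep execution -/

theorem attack_honestOnline (hi : i < 2) (r : ℕ) (log : List Msg) :
    (attack P κ R i).honestOnline (attackPlan R r log) = if r = R then {i, 2} else {i} := by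
  ext p
  simp only [Adversary.honestOnline, attackPlan, attack, Finset.mem_filter, Finset.mem_singleton]
  split_ifs <;> simp only [Finset.mem_insert, Finset.mem_singleton] <;> omega

theorem attack_honestMiners (hi : i < 2) (r : ℕ) (log : List Msg) :
    (attack P κ R i).honestMiners (attackPlan R r log) = {i} := by
  ext p
  rw [Adversary.honestMiners, attack_honestOnline hi, Finset.mem_filter]
  simp only [attackPlan]
  split_ifs <;> simp only [Finset.mem_insert, Finset.mem_singleton] <;> omega

theorem attack_corruptMiners (hi : i < 2) (r : ℕ) (log : List Msg) :
    (attack P κ R i).corruptMiners (attackPlan R r log) = {1 - i} := by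
  ext p
  simp only [Adversary.corruptMiners, attackPlan, attack, Finset.mem_filter, Finset.mem_singleton,
    Finset.mem_insert]
  omega

/-- The configuration `c` at the start of slot `r` agrees with the lockstep execution `l`. -/
structure Tracks (c : Config P (attack P κ R i)) (H : List Bool → List Bool) (r : ℕ)
    (l : Lockstep P) : Prop where
  honest : c.nodes i = l.nodes i
  late : c.nodes 2 = l.nodes 2
  adv : c.adv = ⟨l.nodes (1 - i), (P.step κ (l.nodes (1 - i)).st r [] (issued (1 - i))).pause κ
    (OracleProg.verifier H l.table), l.log⟩
  plan : c.plan = attackPlan R r l.log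
  table : c.table = l.table

theorem Tracks.nodeOut_honest (hi : i < 2) {c : Config P (attack P κ R i)}
    {H : List Bool → List Bool} {r : ℕ} {l : Lockstep P} (h : Tracks c H r l) :
    c.nodeOut κ H r i = l.out κ H r i := by
  have hm : i ∈ (attack P κ R i).honestOnline c.plan := by
    rw [h.plan, attack_honestOnline hi]; split_ifs <;> simp
  have h2 : i ≠ 2 := by omega
  have hmine : decide (i ∈ (attackPlan R r l.log).mining) = true := by
    simp only [attackPlan, Finset.mem_insert, Finset.mem_singleton, decide_eq_true_eq]; omega
  rw [Config.nodeOut, if_pos hm, h.table, h.honest, h.plan, hmine]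
  simp [attackPlan, h2, Lockstep.out]

/-- The table given to the adversary already contains the honest player's computation of slot `r`,
while the paused program has used the table from before it. The budget is `b + 1`: one unit for the
current activation, and `b` for queries that earlier slots left unused. -/
theorem attack_run_step (hi : i < 2) (l : Lockstep P) (r b : ℕ) (sent : ℕ → List Msg)
    (ledgers : ℕ → List Tx) (hs : sent i = (l.out κ (hash κ w.2) r i).2.1) :
    let o := ((attack P κ R i).step ⟨l.nodes (1 - i),
      (P.step κ (l.nodes (1 - i)).st r [] (issued (1 - i))).pause κ
        (OracleProg.verifier (hash κ w.2) l.table), l.log⟩ r sent ledgers).run (hash κ w.2)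
        (l.table ∪ (l.out κ (hash κ w.2) r i).2.2) (b + 1)
    let l' := l.next κ (hash κ w.2) r
    o.1 = (⟨l'.nodes (1 - i), (P.step κ (l'.nodes (1 - i)).st (r + 1) [] (issued (1 - i))).pause κ
        (OracleProg.verifier (hash κ w.2) l'.table), l'.log⟩, attackPlan R (r + 1) l'.log) ∧
      o.2.1 = l'.table := by
  intro o l'
  obtain ⟨h₁, h₂⟩ := Paused.run_resume_pause κ w.2
    (Finset.subset_union_left (s₁ := l.table) (s₂ := (l.out κ (hash κ w.2) r i).2.2)) b
    (P.step κ (l.nodes (1 - i)).st r [] (issued (1 - i)))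
  have hnode : l'.nodes (1 - i) = (l.out κ (hash κ w.2) r (1 - i)).1 :=
    if_pos (by omega : 1 - i < 2)
  have htable : l'.table = l.table ∪ (l.out κ (hash κ w.2) r i).2.2 ∪
      ((P.step κ (l.nodes (1 - i)).st r [] (issued (1 - i))).run (hash κ w.2) l.table 1).2.1 := by
    rw [Finset.union_assoc]
    interval_cases i
    · rfl
    · exact congrArg (l.table ∪ ·) (Finset.union_comm _ _)
  have hlog : l'.log = l.log ++ if i = 0 then
      (l.out κ (hash κ w.2) r i).2.1 ++ (l.out κ (hash κ w.2) r (1 - i)).2.1 else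
      (l.out κ (hash κ w.2) r (1 - i)).2.1 ++ (l.out κ (hash κ w.2) r i).2.1 := by
    interval_cases i <;> rfl
  have hlog' : (if i = 0 then sent 0 ++ (l.out κ (hash κ w.2) r (1 - i)).2.1 else
      (l.out κ (hash κ w.2) r (1 - i)).2.1 ++ sent 1) = if i = 0 then
      (l.out κ (hash κ w.2) r i).2.1 ++ (l.out κ (hash κ w.2) r (1 - i)).2.1 else
      (l.out κ (hash κ w.2) r (1 - i)).2.1 ++ (l.out κ (hash κ w.2) r i).2.1 := by
    interval_cases i <;> simp [hs]
  rw [← hlog'] at hlog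
  simp only [hlog, hnode, htable]
  simp only [o, attack, OracleProg.run_bind, OracleProg.run_pauseProg, OracleProg.run, h₁, h₂]
  simp [Lockstep.out, nodeStep]

/-- The restriction `r < R` keeps player `2` offline; `Lockstep` has no room for its step. -/
theorem Tracks.next (hi : i < 2) {c : Config P (attack P κ R i)} {r : ℕ} (hr : r < R)
    {l : Lockstep P} (h : Tracks c (hash κ w.2) r l) :
    Tracks (c.next κ (hash κ w.2) r) (hash κ w.2) (r + 1) (l.next κ (hash κ w.2) r) := by
  have ho : (attack P κ R i).honestOnline c.plan = {i} := by
    rw [h.plan, attack_honestOnline hi, if_neg hr.ne]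
  have h2 : 2 ∉ (attack P κ R i).honestOnline c.plan := by
    rw [ho, Finset.mem_singleton]; omega
  have hc : (attack P κ R i).corruptMiners c.plan = {1 - i} := by
    rw [h.plan, attack_corruptMiners hi]
  have hstep := attack_run_step (R := R) (w := w) hi l r c.budget
    (fun p => (c.nodeOut κ (hash κ w.2) r p).2.1)
    (fun p => (c.nodeOut κ (hash κ w.2) r p).1.ledger) (by rw [h.nodeOut_honest hi])
  obtain ⟨hstep, htable⟩ := hstep
  refine ⟨?_, ?_, ?_, ?_, ?_⟩
  · simp only [Config.next, h.nodeOut_honest hi, Lockstep.next, if_pos hi]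
  · simp only [Config.next, Config.nodeOut, if_neg h2, h.late]
    rfl
  · simp only [Config.next, ho, hc, Finset.singleton_biUnion, Finset.card_singleton,
      h.nodeOut_honest hi, h.table, h.adv, hstep]
    rfl
  · simp only [Config.next, ho, hc, Finset.singleton_biUnion, Finset.card_singleton,
      h.nodeOut_honest hi, h.table, h.adv, hstep]
  · simp only [Config.next, ho, hc, Finset.singleton_biUnion, Finset.card_singleton,
      h.nodeOut_honest hi, h.table, h.adv, htable]

theorem tracks_lockstep (hi : i < 2) (w : Sample) {r : ℕ} (hr : r ≤ R) :
    Tracks (config P (attack P κ R i) κ w r) (hash κ w.2) r (lockstep P κ w r) := by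
  induction r with
  | zero =>
    have hV : OracleProg.verifier (hash κ w.2) ∅ = fun _ _ => false := by
      funext x y; simp [OracleProg.verifier]
    refine ⟨rfl, rfl, ?_, rfl, rfl⟩
    simp [config, initConfig, attack, lockstep, initNode, hV]
  | succ r ih => exact (ih (by omega)).next hi hr

/-! ### The trace of the attack -/

theorem trace_honest (hi : i < 2) {r : ℕ} (hr : r ≤ R) (len : ℕ) :
    (trace P (attack P κ R i) κ len w).honest r = if r = R then {i, 2} else {i} := by
  simp only [trace, (tracks_lockstep hi w hr).plan, attack_honestOnline hi]

theorem trace_h (hi : i < 2) {r : ℕ} (hr : r ≤ R) (len : ℕ) :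
    (trace P (attack P κ R i) κ len w).h r = 1 := by
  simp only [trace, (tracks_lockstep hi w hr).plan, attack_honestMiners hi, Finset.card_singleton]

theorem trace_n (hi : i < 2) {r : ℕ} (hr : r ≤ R) (len : ℕ) :
    (trace P (attack P κ R i) κ len w).n r = 2 := by
  simp only [trace, (tracks_lockstep hi w hr).plan, attack_honestMiners hi,
    attack_corruptMiners hi, Finset.card_singleton]

theorem trace_sent (hi : i < 2) {r : ℕ} (hr : r ≤ R) (len : ℕ) :
    (trace P (attack P κ R i) κ len w).sent r i = (lockstepOut P κ w r i).2.1 := by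
  simp only [trace, (tracks_lockstep hi w hr).nodeOut_honest hi, lockstepOut]

theorem trace_ledger (hi : i < 2) {r : ℕ} (hr : r ≤ R) (len : ℕ) :
    (trace P (attack P κ R i) κ len w).ledger r i = (lockstepOut P κ w r i).1.ledger := by
  simp only [trace, (tracks_lockstep hi w hr).nodeOut_honest hi, lockstepOut]

/-- This is the indistinguishability: the right-hand side does not depend on `i`. -/
theorem trace_ledger_late (hi : i < 2) (len : ℕ) :
    (trace P (attack P κ R i) κ len w).ledger R 2 = (lateOut P κ w R).1.ledger := by
  have h := tracks_lockstep (P := P) (κ := κ) hi w (le_refl R)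
  have hm : 2 ∈ (attack P κ R i).honestOnline (attackPlan R R (lockstep P κ w R).log) := by
    simp [attack_honestOnline hi]
  simp only [trace, Config.nodeOut, h.plan, h.table, h.late, if_pos hm, lockstep_nodes_two]
  rfl

theorem trace_inbox_late (hi : i < 2) (len : ℕ) :
    (trace P (attack P κ R i) κ len w).inbox R 2 = (lockstep P κ w R).log := by
  simp [trace, (tracks_lockstep hi w le_rfl).plan, attackPlan]

theorem trace_txs (hi : i < 2) {r : ℕ} (hr : r ≤ R) (len : ℕ) :
    (trace P (attack P κ R i) κ len w).txs r i = [payment i] := by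
  simp [trace, (tracks_lockstep hi w hr).plan, attackPlan, issued, Nat.le_of_lt_succ hi]

theorem mem_trace_honest (hi : i < 2) {r : ℕ} (hr : r ≤ R) (len p : ℕ) :
    p ∈ (trace P (attack P κ R i) κ len w).honest r ↔ p = i ∨ r = R ∧ p = 2 := by
  rw [trace_honest hi hr]
  split_ifs with h <;> simp [h]

theorem amount_of_mem_trace_ledger (hi : i < 2) {r : ℕ} (hr : r ≤ R) (len : ℕ) {q : ℕ}
    (hq : q ∈ (trace P (attack P κ R i) κ len w).honest r) {tx : Tx}
    (h : tx ∈ (trace P (attack P κ R i) κ len w).ledger r q) : tx.amount = 0 := by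
  rcases (mem_trace_honest hi hr len q).1 hq with rfl | ⟨rfl, rfl⟩
  · rw [trace_ledger hi hr] at h
    exact amount_of_mem_lockstepOut h
  · rw [trace_ledger_late hi] at h
    exact amount_of_mem_lateOut h

/-! ### Stake: half of it is adversarial in every view -/

theorem transfer_of_amount_eq_zero (N : ℕ) (s : ℕ → ℕ) {tx : Tx} (h : tx.amount = 0) :
    Trace.transfer N s tx = s := by
  simp [Trace.transfer, h]

theorem foldl_transfer_of_amount_eq_zero (N : ℕ) (s : ℕ → ℕ) (l : List Tx)
    (h : ∀ tx ∈ l, tx.amount = 0) : l.foldl (Trace.transfer N) s = s := by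
  induction l with
  | nil => rfl
  | cons tx l ih =>
    rw [List.foldl_cons, transfer_of_amount_eq_zero N s (h tx List.mem_cons_self)]
    exact ih fun tx' h' => h tx' (List.mem_cons_of_mem _ h')

theorem trace_stakeView (hi : i < 2) {r : ℕ} (hr : r ≤ R) (len : ℕ) {q : ℕ}
    (hq : q ∈ (trace P (attack P κ R i) κ len w).honest r) :
    (trace P (attack P κ R i) κ len w).stakeView r q = fun p => if p < 2 then 1 else 0 :=
  foldl_transfer_of_amount_eq_zero _ _ _ fun _ h =>
    amount_of_mem_trace_ledger hi hr len hq (List.mem_eraseDups.1 h)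

theorem trace_corrupt (len : ℕ) : (trace P (attack P κ R i) κ len w).corrupt = {1 - i} := by
  ext p
  refine Finset.mem_filter.trans ?_
  simp only [attack, Finset.mem_singleton]
  omega

theorem trace_advStake (hi : i < 2) {r : ℕ} (hr : r ≤ R) (len : ℕ) {q : ℕ}
    (hq : q ∈ (trace P (attack P κ R i) κ len w).honest r) :
    (trace P (attack P κ R i) κ len w).advStake r q = 1 / 2 := by
  have hN : (trace P (attack P κ R i) κ len w).N = 3 := rfl
  rw [Trace.advStake, trace_stakeView hi hr len hq, trace_corrupt, hN, Finset.sum_singleton]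
  simp only [if_pos (by omega : 1 - i < 2)]
  simp only [Finset.sum_range_succ, Finset.sum_range_zero]
  norm_num

/-! ### The attack obeys the rules and all resource bounds -/

theorem trace_synchronous (hi : i < 2) {Δ : ℕ} (hΔ : 1 ≤ Δ) :
    (trace P (attack P κ R i) κ (R + 1) w).Synchronous Δ := by
  intro r r' p p' hr' hrr' hp hp' hne μ hμ
  have hr' : r' ≤ R := Nat.le_of_lt_succ hr'
  have hp₁ := (mem_trace_honest hi (by omega) _ p).1 hp
  have hp₂ := (mem_trace_honest hi hr' _ p').1 hp'
  -- Since `Δ ≥ 1`, the sending slot is before `R`, when `i` is the only honest player online; a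
  -- different recipient must be player `2` in slot `R`.
  obtain rfl : p = i := by omega
  obtain ⟨rfl, rfl⟩ : r' = R ∧ p' = 2 := by omega
  refine ⟨r', by omega, le_rfl, hp', ?_⟩
  rw [trace_sent hi (by omega)] at hμ
  rw [trace_inbox_late hi]
  exact mem_log_iff.2 ⟨r, by omega, p, hi, hμ⟩

theorem trace_nonDegenerate (hi : i < 2) :
    (trace P (attack P κ R i) κ (R + 1) w).NonDegenerate := by
  refine ⟨Finset.sum_pos' (fun _ _ => Nat.zero_le _) ⟨0, by simp [trace, attack]⟩, fun r hr => ?_⟩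
  have hr : r ≤ R := Nat.le_of_lt_succ hr
  exact ⟨⟨i, (mem_trace_honest hi hr _ i).2 (.inl rfl)⟩, by rw [trace_n hi hr]; norm_num⟩

theorem trace_bounded (hi : i < 2) (m : ℕ) (ω : ℝ) :
    (trace P (attack P κ R i) κ (R + 1) w).Bounded (1 / 2) m ω := by
  intro a b hab hb _
  have hR : ∀ r ∈ Set.Ico a b, r ≤ R := fun r hr => Nat.le_of_lt_succ (hr.2.trans_le hb)
  have ha : a ∈ Set.Ico a b := ⟨le_rfl, hab⟩
  have hw : (trace P (attack P κ R i) κ (R + 1) w).betaW a b = 1 / 2 := by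
    have himage : (fun r => ((trace P (attack P κ R i) κ (R + 1) w).h r : ℝ) /
        (trace P (attack P κ R i) κ (R + 1) w).n r) '' Set.Ico a b = {1 / 2} := by
      rw [Set.image_congr fun r hr => by
        rw [trace_h hi (hR r hr), trace_n hi (hR r hr), Nat.cast_one, Nat.cast_ofNat]]
      exact Set.Nonempty.image_const ⟨a, ha⟩ _
    rw [Trace.betaW, himage, csInf_singleton]
    norm_num
  have hs : (trace P (attack P κ R i) κ (R + 1) w).betaS a b = 1 / 2 := by
    have hset : {x | ∃ r ∈ Set.Ico a b, ∃ q ∈ (trace P (attack P κ R i) κ (R + 1) w).honest r,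
        x = (trace P (attack P κ R i) κ (R + 1) w).advStake r q} = {1 / 2} := by
      ext x
      constructor
      · rintro ⟨r, hr, q, hq, rfl⟩
        exact trace_advStake hi (hR r hr) _ hq
      · rintro rfl
        have hq := (mem_trace_honest (P := P) (κ := κ) (w := w) hi (hR a ha) (R + 1) i).2 (.inl rfl)
        exact ⟨a, ha, i, hq, (trace_advStake hi (hR a ha) _ hq).symm⟩
    rw [Trace.betaS, hset, csSup_singleton]
  rw [hw, hs]
  linarith

theorem respecting_of_eq {γ : ℝ} (hγ : 1 ≤ γ) (s len : ℕ) {x : ℕ → ℕ} {k : ℕ}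
    (hx : ∀ r < len, x r = k) : Trace.Respecting γ s len x := by
  intro a b hb _ r hr r' hr'
  rw [hx r (hr.2.trans_le hb), hx r' (hr'.2.trans_le hb)]
  exact le_mul_of_one_le_left k.cast_nonneg hγ

theorem trace_workRespecting (hi : i < 2) {γ : ℝ} (hγ : 1 ≤ γ) (s : ℕ) :
    (trace P (attack P κ R i) κ (R + 1) w).WorkRespecting γ s :=
  ⟨respecting_of_eq hγ s _ fun _ hr => trace_h hi (Nat.le_of_lt_succ hr) _,
    respecting_of_eq hγ s _ fun _ hr => trace_n hi (Nat.le_of_lt_succ hr) _⟩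

theorem trace_workParticipation (hi : i < 2) {α₀ : ℝ} (hα : α₀ ≤ 1 / 2) :
    (trace P (attack P κ R i) κ (R + 1) w).WorkParticipation α₀ := by
  intro r hr
  rw [trace_h hi (Nat.le_of_lt_succ hr), trace_n hi (Nat.le_of_lt_succ hr)]
  push_cast
  linarith

/-- The late player has no stake, and the other honest player is online from the start. -/
theorem trace_stakeholdersOnline (hi : i < 2) :
    (trace P (attack P κ R i) κ (R + 1) w).StakeholdersOnline := by
  intro r hr q hq p _ hp hpos
  have hr : r ≤ R := Nat.le_of_lt_succ hr
  rw [trace_stakeView hi hr _ hq] at hpos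
  rw [trace_corrupt, Finset.mem_singleton] at hp
  have hp2 : p < 2 := by
    by_contra h
    simp [h] at hpos
  exact (mem_trace_honest hi hr _ p).2 (.inl (by omega))

theorem trace_honestStay (hi : i < 2) :
    (trace P (attack P κ R i) κ (R + 1) w).HonestStay := by
  intro r r' hrr' hr' p hp
  have hr' : r' ≤ R := Nat.le_of_lt_succ hr'
  rw [mem_trace_honest hi (hrr'.trans hr')] at hp
  rw [mem_trace_honest hi hr']
  omega

/-! ### Contradiction from persistence and liveness -/

/-- If the properties hold against the attack, the ledger of the late player extends a ledger with
the transaction of the honest player and no other transaction. -/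
theorem exists_prefix_lateOut (hi : i < 2) {Δ r₁ : ℕ} {u : ℝ} (hu : u < (r₁ + 1 : ℕ))
    (hR : r₁ + Δ < R) (hp : (trace P (attack P κ R i) κ (R + 1) w).Persistence Δ)
    (hl : (trace P (attack P κ R i) κ (R + 1) w).Liveness u) :
    ∃ L, L <+: (lateOut P κ w R).1.ledger ∧ payment i ∈ L ∧ ∀ tx ∈ L, tx = payment i := by
  have hr₁ : r₁ ≤ R := by omega
  refine ⟨(lockstepOut P κ w r₁ i).1.ledger, ?_, ?_,
    fun tx h => eq_payment_of_mem_lockstepOut hi h⟩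
  · rw [← trace_ledger_late hi (R + 1), ← trace_ledger hi hr₁ (R + 1)]
    exact hp r₁ R i 2 (Nat.lt_succ_of_le hr₁) (Nat.lt_succ_self R)
      ((mem_trace_honest hi hr₁ _ i).2 (.inl rfl))
      ((mem_trace_honest hi le_rfl _ 2).2 (.inr ⟨rfl, rfl⟩)) hR
  · obtain ⟨k, hk⟩ := hl (payment i) 0 r₁ (Nat.zero_le _) (Nat.lt_succ_of_le hr₁) hu (by
      intro t ht p hpt
      have htR : t < R := by have := ht.2; omega
      obtain rfl : p = i := by
        have := (mem_trace_honest hi htR.le _ p).1 hpt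
        omega
      rw [trace_txs hi htR.le]
      exact List.mem_singleton_self _)
    have := hk i ((mem_trace_honest hi hr₁ _ i).2 (.inl rfl))
    rw [trace_ledger hi hr₁] at this
    exact List.mem_of_getElem? this

theorem attack_breaks_security {Δ r₁ : ℕ} {u : ℝ} (hu : u < (r₁ + 1 : ℕ)) (hR : r₁ + Δ < R)
    (w : Sample) :
    (¬ ((trace P (attack P κ R 0) κ (R + 1) w).Persistence Δ ∧
        (trace P (attack P κ R 0) κ (R + 1) w).Liveness u)) ∨
      ¬ ((trace P (attack P κ R 1) κ (R + 1) w).Persistence Δ ∧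
        (trace P (attack P κ R 1) κ (R + 1) w).Liveness u) := by
  rw [← not_and_or]
  rintro ⟨⟨hp₀, hl₀⟩, hp₁, hl₁⟩
  obtain ⟨L₀, hL₀, hm₀, ha₀⟩ := exists_prefix_lateOut (by norm_num) hu hR hp₀ hl₀
  obtain ⟨L₁, hL₁, hm₁, ha₁⟩ := exists_prefix_lateOut (by norm_num) hu hR hp₁ hl₁
  -- The payment in the shorter prefix also lies in the longer one, all of whose entries are the
  -- other player's payment.
  rcases List.prefix_or_prefix_of_prefix hL₀ hL₁ with h | h
  · exact absurd (ha₁ _ (h.subset hm₀)) (by decide)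
  · exact absurd (ha₀ _ (h.subset hm₁)) (by decide)

end Attack

/-! ### Probabilities -/

theorem Negligible.exists_add_lt_one {f g : ℕ → ℝ} (hf : Negligible f) (hg : Negligible g) :
    ∃ κ, f κ + g κ < 1 := by
  have h := (hf.add hg) 0
  simp only [pow_zero, one_mul] at h
  exact (h.eventually (gt_mem_nhds one_pos)).exists

instance (P : Protocol) (κ N : ℕ) (stake : ℕ → ℕ) :
    IsProbabilityMeasure (P.sampleMeasure κ N stake) := by
  unfold Protocol.sampleMeasure; infer_instance

/-- No protocol is secure against a class of adversaries that contains the attack. -/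
theorem not_maintainsRobustLedger (P : Protocol) {Δ : ℕ} (hΔ : 1 ≤ Δ) (C : Trace → Prop)
    (hC : ∀ κ R i w, i < 2 → C (trace P (attack P κ R i) κ (R + 1) w)) :
    ¬ P.MaintainsRobustLedger Δ C := by
  rintro ⟨u, ⟨p, hp⟩, hsec⟩
  -- With `p` a polynomial bound for `u`, the slots up to `r₁ = p.eval κ` are numerous enough for
  -- liveness, and `R = r₁ + Δ + 1` is late enough for persistence; the last `1` counts slot `0`.
  have hlen : PolyBounded fun κ => ((p.eval κ + Δ + 1 + 1 : ℕ) : ℝ) :=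
    ⟨p + (Δ + 1 + 1 : ℕ), fun κ => by
      simp only [Polynomial.eval_add, Polynomial.eval_natCast]
      exact_mod_cast (by simp [add_assoc])⟩
  have hneg (i : ℕ) (hi : i < 2) := hsec (fun κ => attack P κ (p.eval κ + Δ + 1) i)
    (fun κ => p.eval κ + Δ + 1 + 1) hlen
    ⟨3, fun κ => by simp [attack]⟩
    fun κ w => ⟨trace_synchronous hi hΔ, trace_nonDegenerate hi, hC κ _ i w hi⟩
  obtain ⟨κ, hκ⟩ := (hneg 0 (by norm_num)).exists_add_lt_one (hneg 1 (by norm_num))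
  refine hκ.not_ge ?_
  have hu : u κ < (p.eval κ + 1 : ℕ) := (hp κ).trans_lt (by push_cast; linarith)
  -- Both attacks have the same number of players and the same initial stake, hence the same
  -- probability space, and their two failure events cover it.
  rw [← probReal_univ (μ := P.sampleMeasure κ 3 fun p => if p < 2 then 1 else 0)]
  refine le_trans (measureReal_mono ?_) (measureReal_union_le _ _)
  exact fun w _ => attack_breaks_security hu (by omega) w

end HybridLedger

theorem mainTheorem3 (P : HybridLedger.Protocol) (Δ : ℕ) (hΔ : 1 ≤ Δ) (m : ℕ)
    (ω : ℝ) (hω₀ : 0 ≤ ω) (hω₁ : ω ≤ 1) :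
    ¬ P.MaintainsRobustLedger Δ (HybridLedger.Trace.Bounded (1 / 2) m ω) ∧
    ∀ (θ γ α₀ : ℝ) (s : ℕ), 1 ≤ γ → 0 < α₀ → α₀ ≤ 1 / 2 →
      P.MaintainsRobustLedger Δ (fun E => E.Bounded θ m ω ∧ E.WorkRespecting γ s ∧
        E.WorkParticipation α₀ ∧ E.StakeholdersOnline ∧ E.HonestStay) →
      θ < 1 / 2 := by
  refine ⟨HybridLedger.not_maintainsRobustLedger P hΔ _ fun κ R i w hi =>
    HybridLedger.trace_bounded hi m ω, fun θ γ α₀ s hγ _ hα hsec => ?_⟩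
  by_contra hθ
  refine HybridLedger.not_maintainsRobustLedger P hΔ _ (fun κ R i w hi => ?_) hsec
  -- For `θ ≥ 1/2`, the same attack is `(θ, m, ω)`-bounded, and it meets all further assumptions.
  exact ⟨fun a b hab hb hm => (HybridLedger.trace_bounded hi m ω a b hab hb hm).trans
      (not_lt.1 hθ), HybridLedger.trace_workRespecting hi hγ s,
    HybridLedger.trace_workParticipation hi hα, HybridLedger.trace_stakeholdersOnline hi,
    HybridLedger.trace_honestStay hi⟩
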